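/- Let $r\ge 1$, let $e_1,\dots,e_{r+1}$ be the standard basis of $\mathbb{R}^{r+1}$, and consider the root system of type $A_r$ (that of $\mathfrak{sl}_{r+1}(\mathbb{C})$) with simple roots $\alpha_i=e_i-e_{i+1}$ for $1\le i\le r$, positive roots $\alpha_i+\alpha_{i+1}+\cdots+\alpha_j$ for $1\le i\le j\le r$, highest root $\tilde\alpha=\alpha_1+\cdots+\alpha_r$, half-sum of positive roots $\rho$, and Weyl group $W$ generated by the reflections $s_1,\dots,s_r$ of $\mathbb{R}^{r+1}$ through the hyperplanes orthogonal to $\alpha_1,\dots,\alpha_r$. Let $\wp(\xi)$ (Kostant's partition function) be the number of ways to write $\xi$ as a linear combination of the positive roots with nonnegative integer coefficients, and for weights $\lambda,\mu$ let $$\mathcal{A}_r(\lambda,\mu)=\{\sigma\in W : \wp(\sigma(\lambda+\rho)-\mu-\rho)>0\}$$ be the Weyl alternation set. Let $X_r$ be the set of sequences $x_1,\dots,x_r$ with $x_i\in\{0,1,2\}$ such that, for every $i$, the entry $x_i$ equals the number of indices $j\in\{1,\dots,r\}$ with $|j-i|=1$ and $x_j<x_i$. Then there is a bijection between $X_r$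 and $\mathcal{A}_r(\tilde\alpha,-\tilde\alpha)$. In particular, $|\mathcal{A}_r(\tilde\alpha,-\tilde\alpha)|=|X_r|$. -/

import Mathlib

/-- The simple root `α_k = e_k - e_{k+1}` of `𝔰𝔩_{r+1}(ℂ)`, as a vector of `ℝ^{r+1}`. The index
`k : Fin r` is zero-based. -/
noncomputable def simpleRoot (r : ℕ) (k : Fin r) : EuclideanSpace ℝ (Fin (r + 1)) :=
  EuclideanSpace.single k.castSucc 1 - EuclideanSpace.single k.succ 1

/-- The indices `(i, j)`, `i ≤ j`, of the positive roots of type `A_r`. -/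
abbrev PosRootIndex (r : ℕ) : Type := {p : Fin r × Fin r // p.1 ≤ p.2}

/-- The positive root `α_{i,j} = α_i + α_{i+1} + ⋯ + α_j`. -/
noncomputable def posRoot (r : ℕ) (p : PosRootIndex r) : EuclideanSpace ℝ (Fin (r + 1)) :=
  ∑ k ∈ Finset.Icc p.1.1 p.1.2, simpleRoot r k

/-- The highest root `α̃ = α_1 + α_2 + ⋯ + α_r`. -/
noncomputable def highestRoot (r : ℕ) : EuclideanSpace ℝ (Fin (r + 1)) :=
  ∑ k : Fin r, simpleRoot r k

/-- `ρ`, half the sum of the positive roots. -/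
noncomputable def weylVector (r : ℕ) : EuclideanSpace ℝ (Fin (r + 1)) :=
  (1 / 2 : ℝ) • ∑ p : PosRootIndex r, posRoot r p

/-- The simple reflection `s_k`: the orthogonal reflection of `ℝ^{r+1}` through the hyperplane
orthogonal to `α_k`. -/
noncomputable def simpleReflection (r : ℕ) (k : Fin r) :
    EuclideanSpace ℝ (Fin (r + 1)) ≃ₗᵢ[ℝ] EuclideanSpace ℝ (Fin (r + 1)) :=
  (Submodule.span ℝ {simpleRoot r k})ᗮ.reflection

/-- The Weyl group of type `A_r`, generated by the simple reflections. -/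
noncomputable def weylGroup (r : ℕ) :
    Subgroup (EuclideanSpace ℝ (Fin (r + 1)) ≃ₗᵢ[ℝ] EuclideanSpace ℝ (Fin (r + 1))) :=
  Subgroup.closure (Set.range (simpleReflection r))

/-- The ways to write `ξ` as a linear combination of the positive roots with nonnegative integer
coefficients. -/
def kostantPartitions (r : ℕ) (ξ : EuclideanSpace ℝ (Fin (r + 1))) :
    Set (PosRootIndex r → ℕ) :=
  {c | ∑ p, c p • posRoot r p = ξ}

/-- Kostant's partition function `℘`: the number of ways to write `ξ` as a linear combination of
the positive roots with nonnegative integer coefficients. (This number is finite, see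
`kostantPartitions_finite`.) -/
noncomputable def kostantPartitionFunction (r : ℕ) (ξ : EuclideanSpace ℝ (Fin (r + 1))) : ℕ :=
  (kostantPartitions r ξ).ncard

/-- The Weyl alternation set
`𝒜_r(lam, mu) = {σ ∈ W | ℘(σ(lam + ρ) - mu - ρ) > 0}`. -/
def weylAlternationSet (r : ℕ) (lam mu : EuclideanSpace ℝ (Fin (r + 1))) :
    Set (weylGroup r) :=
  {σ | 0 < kostantPartitionFunction r
    ((σ : EuclideanSpace ℝ (Fin (r + 1)) ≃ₗᵢ[ℝ] EuclideanSpace ℝ (Fin (r + 1)))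
      (lam + weylVector r) - mu - weylVector r)}

/-- `X_r`: the sequences `x_1, …, x_r` with entries in `{0, 1, 2}` in which every entry `x_i` equals
the number of its neighbours (the positions `j` with `|j - i| = 1`) that are smaller than `x_i`. -/
def neighbourSequences (r : ℕ) : Set (Fin r → Fin 3) :=
  {x | ∀ i : Fin r,
    (x i : ℕ) = (Finset.univ.filter fun j : Fin r => |(j : ℤ) - (i : ℤ)| = 1 ∧ x j < x i).card}

/-- Explicit form of the simple reflection: `s_k(v) = v - 2 (α_k, v) / (α_k, α_k) α_k`. -/
theorem simpleReflection_apply (r : ℕ) (k : Fin r) (v : EuclideanSpace ℝ (Fin (r + 1))) :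
    simpleReflection r k v =
      v - (2 * (inner ℝ (simpleRoot r k) v / inner ℝ (simpleRoot r k) (simpleRoot r k))) •
        simpleRoot r k := by
  unfold simpleReflection
  rw [Submodule.reflection_orthogonal_apply, Submodule.reflection_singleton_apply,
    real_inner_self_eq_norm_sq]
  simp [two_mul, add_smul, two_smul]

theorem sum_simpleRoot_apply (r : ℕ) (k m : Fin r) :
    ∑ i ∈ Finset.Iic m.castSucc, simpleRoot r k i = if k = m then 1 else 0 := by
  have h1 : ∀ a : Fin (r + 1), ∑ i ∈ Finset.Iic m.castSucc,
      (EuclideanSpace.single a (1 : ℝ) : EuclideanSpace ℝ (Fin (r + 1))) i =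
        if a ≤ m.castSucc then 1 else 0 := by
    intro a
    simp
  simp only [simpleRoot, PiLp.sub_apply, Finset.sum_sub_distrib, h1, Fin.le_def, Fin.ext_iff,
    Fin.val_castSucc, Fin.val_succ]
  split_ifs <;> first | omega | norm_num

theorem sum_posRoot_apply (r : ℕ) (p : PosRootIndex r) (m : Fin r) :
    ∑ i ∈ Finset.Iic m.castSucc, posRoot r p i =
      if m ∈ Finset.Icc p.1.1 p.1.2 then 1 else 0 := by
  simp only [posRoot, WithLp.ofLp_sum, Finset.sum_apply]
  rw [Finset.sum_comm]
  simp only [sum_simpleRoot_apply, Finset.sum_ite_eq']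

/-- The positive roots `α_{i,j}` are pairwise distinct, so that a family of coefficients indexed by
the pairs `(i, j)` is the same as one indexed by the set of positive roots. -/
theorem posRoot_injective (r : ℕ) : Function.Injective (posRoot r) := by
  rintro ⟨⟨a, b⟩, hab⟩ ⟨⟨c, d⟩, hcd⟩ h
  have key : ∀ m : Fin r, m ∈ Finset.Icc a b ↔ m ∈ Finset.Icc c d := by
    intro m
    have h1 := sum_posRoot_apply r ⟨(a, b), hab⟩ m
    rw [h, sum_posRoot_apply] at h1
    dsimp only at h1
    split_ifs at h1 with h3 h2 h2
    · exact iff_of_true h2 h3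
    · norm_num at h1
    · norm_num at h1
    · exact iff_of_false h2 h3
  simp only [Finset.mem_Icc] at key hab hcd
  have e1 := (key a).1 ⟨le_rfl, hab⟩
  have e2 := (key b).1 ⟨hab, le_rfl⟩
  have e3 := (key c).2 ⟨le_rfl, hcd⟩
  have e4 := (key d).2 ⟨hcd, le_rfl⟩
  have ha : a = c := le_antisymm e3.1 e1.1
  have hb : b = d := le_antisymm e2.2 e4.2
  subst ha hb
  rfl

/-- Every vector has only finitely many expressions as a linear combination of the positive roots
with nonnegative integer coefficients. -/
theorem kostantPartitions_finite (r : ℕ) (ξ : EuclideanSpace ℝ (Fin (r + 1))) :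
    (kostantPartitions r ξ).Finite := by
  refine (Set.finite_Iic
    (fun p : PosRootIndex r => ⌊∑ i ∈ Finset.Iic p.1.1.castSucc, ξ i⌋₊)).subset ?_
  rintro c rfl p
  refine Nat.le_floor ?_
  simp only [WithLp.ofLp_sum, Finset.sum_apply]
  rw [Finset.sum_comm]
  have h : ∀ q : PosRootIndex r, ∑ i ∈ Finset.Iic p.1.1.castSucc, (c q • posRoot r q) i =
      (c q : ℝ) * if p.1.1 ∈ Finset.Icc q.1.1 q.1.2 then 1 else 0 := by
    intro q
    rw [← sum_posRoot_apply, Finset.mul_sum]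
    simp
  simp only [h]
  have := Finset.single_le_sum (s := Finset.univ)
    (f := fun q : PosRootIndex r =>
      (c q : ℝ) * if p.1.1 ∈ Finset.Icc q.1.1 q.1.2 then 1 else 0)
    (fun q _ => by positivity) (Finset.mem_univ p)
  simpa [p.2] using this

/-! Write each coordinate as r/2 minus an integer: ρ gives 0, 1, …, r and α̃ + ρ gives the distinct
integers -1, 1, …, r-1, r+1. W permutes coordinates, and ℘(ξ) > 0 exactly when ξ = ∑ n_k α_k with
natural n_k. Put e_k = 2 - n_k and e_0 = e_{r+1} = 1. Comparing coordinates in σ(α̃ + ρ) + α̃ - ρ =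
∑ n_k α_k shows that i ↦ i + e_{i+1} - e_i, for 0 ≤ i ≤ r, takes each of the values -1, 1, …, r-1,
r+1 once. The alternation set thus corresponds to the sequences e ≤ 2 for which this map is such a
bijection.

The first k values sum to e_k more than the k smallest admissible values, so e_k ≥ 0, with equality
exactly when they are those k smallest (`displacement_pos_iff`). Hence e_k ∈ {0, 1, 2}, and recoding
e = 0, 2, 1 as x = 0, 1, 2 turns bijectivity into the local neighbour rule:
`neighbour_condition_of_displacement` gives one direction, `displacement_mem` and
`displacement_injOn` the other. -/

/-! ### Combinatorics of the displacement sequences e. -/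

/-- A sequence of displacements satisfying the neighbour conditions makes `i ↦ i + e (i+1) - e i`
avoid the values `0` and `r`. -/
theorem displacement_mem {r : ℕ} {e : ℕ → ℤ} (h0 : e 0 = 1) (h1 : e (r + 1) = 1)
    (he : ∀ k, 0 ≤ e k ∧ e k ≤ 2)
    (hX : ∀ k < r, (e (k + 1) = 1 → e k ≠ 1 ∧ e (k + 2) ≠ 1) ∧
      (e (k + 1) = 2 → (e k = 0 ↔ e (k + 2) ≠ 0))) {i : ℕ} (hi : i ≤ r) (hr : 1 ≤ r) :
    (i : ℤ) + e (i + 1) - e i = -1 ∨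
      (1 ≤ (i : ℤ) + e (i + 1) - e i ∧ (i : ℤ) + e (i + 1) - e i ≤ r - 1) ∨
      (i : ℤ) + e (i + 1) - e i = r + 1 := by
  have low : (i : ℤ) + e (i + 1) - e i = -1 ∨ 1 ≤ (i : ℤ) + e (i + 1) - e i := by
    have b1 := he i
    have b2 := he (i + 1)
    -- Displacements are at least -2, so only i ≤ 2 can reach a value ≤ 0. The upper bound is the
    -- mirror image, with d = r - i.
    obtain rfl | rfl | rfl | hi3 : i = 0 ∨ i = 1 ∨ i = 2 ∨ 3 ≤ i := by omega
    · have := hX 0 (by omega)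
      simp only [zero_add] at *
      omega
    · have := hX 0 (by omega)
      have := he 3
      simp only [zero_add, Nat.reduceAdd] at *
      push_cast
      omega
    · have := hX 0 (by omega)
      have := hX 1 (by omega)
      have := he 1
      simp only [zero_add, Nat.reduceAdd] at *
      push_cast
      omega
    · omega
  have high : (i : ℤ) + e (i + 1) - e i ≤ r - 1 ∨ (i : ℤ) + e (i + 1) - e i = r + 1 := by
    have b1 := he i
    have b2 := he (i + 1)
    obtain ⟨d, rfl⟩ := Nat.exists_eq_add_of_le hi
    obtain rfl | rfl | rfl | hd : d = 0 ∨ d = 1 ∨ d = 2 ∨ 3 ≤ d := by omega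
    · obtain ⟨j, rfl⟩ := Nat.exists_eq_add_of_le' hr
      have := hX j (by omega)
      simp only [add_zero, add_assoc, Nat.reduceAdd] at *
      push_cast
      omega
    · have := hX i (by omega)
      simp only [add_assoc, Nat.reduceAdd] at *
      push_cast
      omega
    · have := hX i (by omega)
      have := hX (i + 1) (by omega)
      have := he (i + 2)
      simp only [add_assoc, Nat.reduceAdd] at *
      push_cast
      omega
    · push_cast
      omega
  omega

/-- Displacements lie in [-2, 2], so a collision forces j - i ≤ 4; the neighbour rule excludes each
remaining gap. -/
theorem displacement_injOn {r : ℕ} {e : ℕ → ℤ} (h0 : e 0 = 1) (h1 : e (r + 1) = 1)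
    (he : ∀ k, 0 ≤ e k ∧ e k ≤ 2)
    (hX : ∀ k < r, (e (k + 1) = 1 → e k ≠ 1 ∧ e (k + 2) ≠ 1) ∧
      (e (k + 1) = 2 → (e k = 0 ↔ e (k + 2) ≠ 0))) {i j : ℕ} (hij : i < j) (hj : j ≤ r) :
    (i : ℤ) + e (i + 1) - e i ≠ j + e (j + 1) - e j := by
  intro H
  have b1 := he i
  have b2 := he (i + 1)
  have b3 := he j
  have b4 := he (j + 1)
  obtain ⟨d, rfl⟩ := Nat.exists_eq_add_of_lt hij
  -- The rule centred at i, with i = 0 kept apart because `i - 1` truncates.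
  have left : e i = 1 ∧ i = 0 ∨ (e i = 1 → e (i + 1) ≠ 1) ∧ (e i = 2 → e (i + 1) = 0 →
      1 ≤ e (i - 1)) ∧ (e i = 2 → e (i + 1) ≠ 0 → e (i - 1) = 0) := by
    obtain rfl | ⟨m, rfl⟩ : i = 0 ∨ ∃ m, i = m + 1 := by
      cases i <;> simp
    · simp [h0]
    · right
      have := hX m (by omega)
      have := he m
      simp only [add_assoc, Nat.reduceAdd, Nat.add_sub_cancel] at *
      omega
  have c1 := hX i (by omega)
  obtain rfl | rfl | rfl | rfl | hd : d = 0 ∨ d = 1 ∨ d = 2 ∨ d = 3 ∨ 4 ≤ d := by omega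
  · have c2 : i + 1 < r → _ := hX (i + 1)
    -- At the right end the rule centred at `e (i + 2)` is missing; the boundary value 1 replaces
    -- it.
    have c3 : i + 1 < r ∨ e (i + 2) = 1 := by
      by_cases h : i + 1 < r
      · exact Or.inl h
      · right; rw [← h1]; congr 1; omega
    simp only [add_assoc, Nat.reduceAdd] at *
    push_cast at H
    omega
  · have c2 := hX (i + 1) (by omega)
    have b5 := he (i + 2)
    have c2 : i + 2 < r → _ := hX (i + 2)
    have c3 : i + 2 < r ∨ e (i + 3) = 1 := by
      by_cases h : i + 2 < r
      · exact Or.inl h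
      · right; rw [← h1]; congr 1; omega
    simp only [add_assoc, Nat.reduceAdd] at *
    push_cast at H
    omega
  · have c2 := hX (i + 1) (by omega)
    have c2 := hX (i + 2) (by omega)
    have b5 := he (i + 2)
    simp only [add_assoc, Nat.reduceAdd] at *
    push_cast at H
    omega
  · have c2 := hX (i + 1) (by omega)
    have c2 := hX (i + 2) (by omega)
    have c2 := hX (i + 3) (by omega)
    have b5 := he (i + 2)
    have b5 := he (i + 3)
    simp only [add_assoc, Nat.reduceAdd] at *
    push_cast at H
    omega
  · push_cast at H
    omega

/-- The defect `e k` compares the sum of the first `k` values with the smallest sum possible. -/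
theorem displacement_pos_iff {r : ℕ} {e : ℕ → ℤ} (h0 : e 0 = 1)
    (hW : ∀ i ≤ r, (i : ℤ) + e (i + 1) - e i = -1 ∨
      (1 ≤ (i : ℤ) + e (i + 1) - e i ∧ (i : ℤ) + e (i + 1) - e i ≤ r - 1) ∨
      (i : ℤ) + e (i + 1) - e i = r + 1)
    (hinj : Set.InjOn (fun i : ℕ => (i : ℤ) + e (i + 1) - e i) (Set.Iic r))
    {k : ℕ} (hk : 1 ≤ k) (hkr : k ≤ r) :
    0 ≤ e k ∧ (e k ≠ 0 ↔ ∃ j < k, (k : ℤ) ≤ (j : ℤ) + e (j + 1) - e j) := by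
  set f : ℕ → ℤ := fun i : ℕ => (i : ℤ) + e (i + 1) - e i with hf
  set A : Finset ℤ := (Finset.range k).image f with hA
  -- The k smallest admissible values; 0 is not among them.
  set B : Finset ℤ := insert (-1) (Finset.Ico 1 (k : ℤ)) with hB
  have injk : Set.InjOn f (Finset.range k) := hinj.mono fun i hi => by
    simp at hi ⊢; omega
  have cA : A.card = k := by rw [hA, Finset.card_image_of_injOn injk, Finset.card_range]
  have cB : B.card = k := by
    rw [hB, Finset.card_insert_of_notMem (by simp), Int.card_Ico]; omega
  have sA : ∑ a ∈ A, a = ∑ j ∈ Finset.range k, (j : ℤ) + e k - 1 := by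
    rw [hA, Finset.sum_image injk]
    simp only [hf, add_sub_assoc, Finset.sum_add_distrib, Finset.sum_range_sub, h0]
  have sB : ∑ b ∈ B, b = ∑ j ∈ Finset.range k, (j : ℤ) - 1 := by
    rw [hB, Finset.sum_insert (by simp)]
    have : ∀ n : ℕ, 1 ≤ n → ∑ b ∈ Finset.Ico 1 (n : ℤ), b = ∑ j ∈ Finset.range n, (j : ℤ) := by
      intro n hn
      induction n, hn using Nat.le_induction with
      | base => simp
      | succ n hn ih =>
        rw [Finset.sum_range_succ, ← ih, Nat.cast_succ,
          show Finset.Ico (1 : ℤ) (n + 1) = insert (n : ℤ) (Finset.Ico 1 (n : ℤ)) by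
            ext; simp; omega, Finset.sum_insert (by simp)]
        ring
    rw [this k hk]; ring
  have hAk : ∀ a ∈ A \ B, (k : ℤ) ≤ a := by
    intro a ha
    simp only [hA, hB, Finset.mem_sdiff, Finset.mem_image, Finset.mem_range, Finset.mem_insert,
      Finset.mem_Ico] at ha
    obtain ⟨⟨i, hi, rfl⟩, hb⟩ := ha
    have := hW i (by omega)
    simp only [hf] at hb ⊢
    omega
  have hBk : ∀ b ∈ B \ A, b ≤ (k : ℤ) - 1 := by
    intro b hb
    simp only [hB, Finset.mem_sdiff, Finset.mem_insert, Finset.mem_Ico] at hb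
    omega
  have cAB : (A \ B).card = (B \ A).card := Finset.card_sdiff_comm (cA.trans cB.symm)
  -- The sums of A and B differ by `e k`, and trading an element of B \ A for one of A \ B raises
  -- the sum by at least 1.
  have hge : ((A \ B).card : ℤ) ≤ e k := by
    have e1 := Finset.card_nsmul_le_sum _ _ _ hAk
    have e2 := Finset.sum_le_card_nsmul _ _ _ hBk
    have e3 := Finset.sum_inter_add_sum_sdiff A B (fun a => a)
    have e4 := Finset.sum_inter_add_sum_sdiff B A (fun a => a)
    rw [Finset.inter_comm] at e4
    rw [← cAB] at e2
    simp only [nsmul_eq_mul] at e1 e2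
    linarith
  refine ⟨by omega, fun h => ?_, ?_⟩
  · by_contra! hc
    have : A ⊆ B := by
      intro a ha
      by_contra hb
      have h1 := hAk a (Finset.mem_sdiff.2 ⟨ha, hb⟩)
      obtain ⟨i, hi, rfl⟩ := Finset.mem_image.1 ha
      have h2 := hc i (Finset.mem_range.1 hi)
      simp only [hf] at h1
      omega
    have hAB := Finset.eq_of_subset_of_card_le this (by omega)
    rw [hAB] at sA
    omega
  · rintro ⟨j, hj, hjk⟩ h
    have : f j ∈ A \ B := by
      simp only [hA, hB, Finset.mem_sdiff, Finset.mem_insert, Finset.mem_Ico, not_or]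
      refine ⟨Finset.mem_image_of_mem _ (Finset.mem_range.2 hj), ?_, ?_⟩ <;>
        simp only [hf] <;> omega
    have := Finset.card_pos.2 ⟨_, this⟩
    omega

/-- A nonzero `e (k + 1)` means that a value ≥ k + 1 occurs at an argument ≤ k. Displacements are at
most 2, so that argument is k or k - 1; a violated rule then repeats a value or hits a forbidden
one. -/
theorem neighbour_condition_of_displacement {r : ℕ} {e : ℕ → ℤ} (h0 : e 0 = 1)
    (h1 : e (r + 1) = 1) (he : ∀ k, e k ≤ 2)
    (hW : ∀ i ≤ r, (i : ℤ) + e (i + 1) - e i = -1 ∨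
      (1 ≤ (i : ℤ) + e (i + 1) - e i ∧ (i : ℤ) + e (i + 1) - e i ≤ r - 1) ∨
      (i : ℤ) + e (i + 1) - e i = r + 1)
    (hinj : Set.InjOn (fun i : ℕ => (i : ℤ) + e (i + 1) - e i) (Set.Iic r)) :
    ∀ k < r, (e (k + 1) = 1 → e k ≠ 1 ∧ e (k + 2) ≠ 1) ∧
      (e (k + 1) = 2 → (e k = 0 ↔ e (k + 2) ≠ 0)) := by
  have key : ∀ k, 1 ≤ k → k ≤ r → _ := fun k => displacement_pos_iff h0 hW hinj (k := k)
  have nonneg : ∀ k ≤ r + 1, 0 ≤ e k := by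
    intro k hk
    rcases Nat.eq_zero_or_pos k with rfl | hk0
    · omega
    · rcases Nat.lt_or_ge r k with h | h
      · rw [show k = r + 1 by omega]; omega
      · exact (key k hk0 h).1
  have ne : ∀ i ≤ r, ∀ j ≤ r, i ≠ j → (i : ℤ) + e (i + 1) - e i ≠ j + e (j + 1) - e j :=
    fun i hi j hj hij H => hij (hinj hi hj H)
  have exceed : ∀ k < r, e (k + 1) ≠ 0 → (k : ℤ) + 1 ≤ k + e (k + 1) - e k ∨
      ∃ m, k = m + 1 ∧ (m : ℤ) + 2 ≤ m + e (m + 1) - e m := by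
    intro k hk h
    obtain ⟨j, hj, hjk⟩ := (key (k + 1) (by omega) hk).2.1 h
    have := nonneg j (by omega)
    have := he (j + 1)
    push_cast at hjk
    obtain rfl | hj' : j = k ∨ k = j + 1 := by omega
    · exact Or.inl hjk
    · subst hj'
      push_cast at hjk
      exact Or.inr ⟨j, rfl, by omega⟩
  -- Two adjacent ones give the value k at k; this is forbidden for k = 0, and otherwise already
  -- taken at k - 1 or k - 2.
  have not_one : ∀ k ≤ r, e k = 1 → e (k + 1) ≠ 1 := by
    intro k hk ek ek'
    have hk' := hW k hk
    obtain rfl | ⟨m, rfl⟩ : k = 0 ∨ ∃ m, k = m + 1 := by cases k <;> simp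
    · omega
    · have n0 := nonneg m (by omega)
      have n1 := ne m (by omega) (m + 1) hk (by omega)
      rcases exceed m hk (by omega) with h | ⟨p, rfl, h⟩
      · push_cast at *
        omega
      · have n1 := ne p (by omega) (p + 1 + 1) hk (by omega)
        have := nonneg p (by omega)
        have := he (p + 1)
        push_cast at *
        omega
  intro k hk
  refine ⟨fun h => ⟨fun h' => not_one k hk.le h' h, not_one (k + 1) hk h⟩, fun h => ⟨?_, ?_⟩⟩
  · intro hk0 hk2
    have hkr : k + 2 ≤ r := by
      by_contra hc
      rw [show k + 2 = r + 1 by omega] at hk2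
      omega
    have := (key (k + 2) (by omega) hkr).2.2 ⟨k, by omega, by push_cast; omega⟩
    exact this hk2
  · intro hk2
    by_contra hk0
    have a0 := nonneg k (by omega)
    have a2 := nonneg (k + 2) (by omega)
    have a3 := he (k + 2)
    have a4 := hW (k + 1) (by omega)
    have a5 := he k
    -- the value `k + 1` is attained at an argument `j ≤ k`
    have att : ∃ j ≤ k, (j : ℤ) + e (j + 1) - e j = k + 1 := by
      rcases exceed k hk (by omega) with h' | ⟨m, rfl, h'⟩
      · exact ⟨k, le_rfl, by omega⟩
      · refine ⟨m, by omega, ?_⟩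
        have := nonneg m (by omega)
        push_cast
        omega
    obtain ⟨j, hj, hjk⟩ := att
    have b1 := ne j (by omega) (k + 1) (by omega) (by omega)
    have b2 := hW j (by omega)
    -- With `e (k + 2) = 2` the value k + 1 would recur at the argument k + 1.
    have hk21 : e (k + 2) = 1 := by
      simp only [add_assoc, Nat.reduceAdd] at *
      push_cast at *
      omega
    by_cases hkr : k + 1 < r
    · rcases exceed (k + 1) hkr (by omega) with h' | ⟨m, hm, h'⟩
      · simp only [add_assoc, Nat.reduceAdd] at *
        push_cast at *
        omega
      · obtain rfl : k = m := by omega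
        omega
    -- Here k + 1 = r, and the attained value r is not admissible.
    · omega

/-! ### Coordinates of root combinations, ρ and α̃. -/

/-- Extend a sequence indexed by `Fin r` to `ℕ`, shifting it by one and using the value `d` outside
the positions `1, …, r`. -/
def padded {R : Type*} {r : ℕ} (d : R) (c : Fin r → R) : ℕ → R
  | 0 => d
  | k + 1 => if h : k < r then c ⟨k, h⟩ else d

@[simp]
theorem padded_zero {R : Type*} {r : ℕ} (d : R) (c : Fin r → R) : padded d c 0 = d := rfl

theorem padded_succ_of_lt {R : Type*} {r : ℕ} (d : R) (c : Fin r → R) {k : ℕ} (h : k < r) :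
    padded d c (k + 1) = c ⟨k, h⟩ := dif_pos h

theorem padded_succ_of_le {R : Type*} {r : ℕ} (d : R) (c : Fin r → R) {k : ℕ} (h : r ≤ k) :
    padded d c (k + 1) = d := dif_neg h.not_gt

theorem padded_map {R S : Type*} {r : ℕ} (g : R → S) (d : R) (c : Fin r → R) (k : ℕ) :
    padded (g d) (fun i => g (c i)) k = g (padded d c k) := by
  cases k with
  | zero => rfl
  | succ k => simp only [padded]; split_ifs <;> rfl

theorem padded_eq_of_forall {R : Type*} {r : ℕ} {d : R} {c : Fin r → R} {P : R → Prop}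
    (hd : P d) (hc : ∀ i, P (c i)) (k : ℕ) : P (padded d c k) := by
  cases k with
  | zero => exact hd
  | succ k => simp only [padded]; split_ifs; exacts [hc _, hd]

theorem sum_smul_simpleRoot_apply {r : ℕ} (c : Fin r → ℝ) (i : Fin (r + 1)) :
    (∑ k, c k • simpleRoot r k) i = padded 0 c (i + 1) - padded 0 c i := by
  have h : (∑ k, c k • simpleRoot r k) i =
      ∑ k, (if i = k.castSucc then c k else 0) - ∑ k, (if i = k.succ then c k else 0) := by
    simp [simpleRoot, mul_sub, Finset.sum_sub_distrib, Pi.single_apply]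
  rw [h]
  congr 1
  · induction i using Fin.lastCases with
    | last =>
      rw [Fin.val_last, padded_succ_of_le _ _ le_rfl]
      exact Finset.sum_eq_zero fun k _ => if_neg (Fin.castSucc_lt_last k).ne'
    | cast j => simp [padded]
  · induction i using Fin.cases with
    | zero => exact Finset.sum_eq_zero fun k _ => if_neg (Fin.succ_ne_zero k).symm
    | succ j => simp [padded]

theorem sum_smul_simpleRoot_injective {r : ℕ} {c d : Fin r → ℝ}
    (h : ∑ k, c k • simpleRoot r k = ∑ k, d k • simpleRoot r k) : c = d := by
  have key : ∀ (c : Fin r → ℝ) (m : Fin r),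
      ∑ i ∈ Finset.Iic m.castSucc, (∑ k, c k • simpleRoot r k) i = c m := by
    intro c m
    simp only [WithLp.ofLp_sum, Finset.sum_apply, PiLp.smul_apply, smul_eq_mul]
    rw [Finset.sum_comm]
    simp [← Finset.mul_sum, sum_simpleRoot_apply]
  funext m
  rw [← key c, ← key d, h]

/-- Positive roots are sums of simple roots, and simple roots are positive, so both generate the
same cone over ℕ. -/
theorem kostantPartitionFunction_pos_iff {r : ℕ} {ξ : EuclideanSpace ℝ (Fin (r + 1))} :
    0 < kostantPartitionFunction r ξ ↔
      ∃ n : Fin r → ℕ, ξ = ∑ k, (n k : ℝ) • simpleRoot r k := by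
  rw [kostantPartitionFunction, Set.ncard_pos (kostantPartitions_finite r ξ)]
  constructor
  · rintro ⟨c, rfl⟩
    refine ⟨fun k => ∑ p : PosRootIndex r, if k ∈ Finset.Icc p.1.1 p.1.2 then c p else 0, ?_⟩
    simp only [posRoot, Finset.smul_sum, Nat.cast_sum, Finset.sum_smul]
    rw [Finset.sum_comm]
    refine Finset.sum_congr rfl fun p _ => ?_
    simp only [Nat.cast_ite, Nat.cast_zero, ite_smul, zero_smul, Finset.sum_ite_mem,
      Finset.univ_inter, Nat.cast_smul_eq_nsmul]
  · rintro ⟨n, rfl⟩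
    refine ⟨fun p => if p.1.1 = p.1.2 then n p.1.1 else 0, ?_⟩
    simp only [kostantPartitions, Set.mem_ofPred_eq, ite_smul, zero_smul]
    rw [← Finset.sum_filter]
    refine Finset.sum_bij' (fun p _ => p.1.1) (fun k _ => ⟨(k, k), le_rfl⟩) ?_ ?_ ?_ ?_ ?_
    · simp
    · simp
    · rintro ⟨⟨a, b⟩, h⟩ hp
      simp at hp ⊢
      exact hp
    · simp
    · rintro ⟨⟨a, b⟩, h⟩ hp
      obtain rfl : a = b := by simpa using hp
      simp [posRoot, Nat.cast_smul_eq_nsmul]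

theorem card_posRootIndex_filter {r : ℕ} (k : Fin r) :
    (Finset.univ.filter fun p : PosRootIndex r => k ∈ Finset.Icc p.1.1 p.1.2).card =
      (k + 1) * (r - k) := by
  rw [← Fin.card_Iic k, ← Fin.card_Ici k, ← Finset.card_product]
  refine Finset.card_bij (fun p _ => p.1) ?_ ?_ ?_
  · simp
  · exact fun _ _ _ _ h => Subtype.ext h
  · rintro ⟨a, b⟩ h
    simp only [Finset.mem_product, Finset.mem_Iic, Finset.mem_Ici] at h
    exact ⟨⟨(a, b), h.1.trans h.2⟩, by simpa using h, rfl⟩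

theorem weylVector_apply (r : ℕ) (i : Fin (r + 1)) :
    weylVector r i = (r : ℝ) / 2 - (i : ℕ) := by
  -- The coefficient of a simple root in ρ is half the number of positive roots containing it.
  have h : weylVector r =
      ∑ k : Fin r, ((((k : ℕ) : ℝ) + 1) * (r - (k : ℕ)) / 2) • simpleRoot r k := by
    have : ∀ p : PosRootIndex r, posRoot r p =
        ∑ k, if k ∈ Finset.Icc p.1.1 p.1.2 then simpleRoot r k else 0 := by
      intro p
      rw [Finset.sum_ite_mem, Finset.univ_inter, posRoot]
    simp only [weylVector, this]
    rw [Finset.sum_comm, Finset.smul_sum]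
    refine Finset.sum_congr rfl fun k _ => ?_
    rw [← Finset.sum_filter, Finset.sum_const, card_posRootIndex_filter,
      ← Nat.cast_smul_eq_nsmul ℝ, smul_smul]
    push_cast [k.2.le]
    congr 1
    ring
  have hp : ∀ j : ℕ, j ≤ r + 1 →
      padded 0 (fun k : Fin r => (((k : ℕ) : ℝ) + 1) * (r - (k : ℕ)) / 2) j =
        (j : ℝ) * (r + 1 - j) / 2 := by
    intro j hj
    cases j with
    | zero => simp
    | succ j =>
      rcases Nat.lt_or_ge j r with h | h
      · rw [padded_succ_of_lt _ _ h]; push_cast; ring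
      · obtain rfl : j = r := by omega
        rw [padded_succ_of_le _ _ h]; simp
  rw [h, sum_smul_simpleRoot_apply, hp _ (by omega), hp _ (by omega)]
  push_cast
  ring

theorem highestRoot_apply (r : ℕ) (hr : 1 ≤ r) (i : Fin (r + 1)) :
    highestRoot r i = (if (i : ℕ) = 0 then 1 else 0) - if (i : ℕ) = r then 1 else 0 := by
  have h : highestRoot r = ∑ k : Fin r, (1 : ℝ) • simpleRoot r k := by simp [highestRoot]
  rw [h, sum_smul_simpleRoot_apply]
  obtain ⟨i, hi⟩ := i
  cases i with
  | zero => simp [padded, Nat.pos_iff_ne_zero.1 hr, (Nat.pos_iff_ne_zero.1 hr).symm]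
  | succ i =>
    rw [padded_succ_of_lt _ _ (show i < r by omega)]
    simp only [padded]
    split_ifs <;> simp_all <;> omega

/-! ### The Weyl group as coordinate permutations, acting on α̃ + ρ. -/

/-- The isometry of `ℝ^{r+1}` permuting the coordinates. -/
noncomputable def permIsometry {r : ℕ} (π : Equiv.Perm (Fin (r + 1))) :
    EuclideanSpace ℝ (Fin (r + 1)) ≃ₗᵢ[ℝ] EuclideanSpace ℝ (Fin (r + 1)) :=
  LinearIsometryEquiv.piLpCongrLeft 2 ℝ ℝ π

theorem permIsometry_apply {r : ℕ} (π : Equiv.Perm (Fin (r + 1)))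
    (v : EuclideanSpace ℝ (Fin (r + 1))) (i : Fin (r + 1)) :
    permIsometry π v i = v (π.symm i) := rfl

/-- `permIsometry` as a group homomorphism. -/
noncomputable def permIsometryHom (r : ℕ) : Equiv.Perm (Fin (r + 1)) →*
    EuclideanSpace ℝ (Fin (r + 1)) ≃ₗᵢ[ℝ] EuclideanSpace ℝ (Fin (r + 1)) where
  toFun := permIsometry
  map_one' := rfl
  map_mul' _ _ := by ext; rfl

theorem simpleReflection_eq_permIsometry {r : ℕ} (k : Fin r) :
    simpleReflection r k = permIsometry (Equiv.swap k.castSucc k.succ) := by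
  have hne : k.castSucc ≠ k.succ := Fin.castSucc_lt_succ.ne
  ext v i
  have inn : ∀ v : EuclideanSpace ℝ (Fin (r + 1)),
      inner ℝ (simpleRoot r k) v = v k.castSucc - v k.succ := by
    intro v
    simp [simpleRoot, inner_sub_left, EuclideanSpace.inner_single_left]
  rw [simpleReflection_apply, permIsometry_apply, inn, inn, Equiv.symm_swap]
  rcases eq_or_ne i k.castSucc with rfl | h1
  · rw [Equiv.swap_apply_left]
    simp [simpleRoot, hne, hne.symm]
    ring
  · rcases eq_or_ne i k.succ with rfl | h2
    · rw [Equiv.swap_apply_right]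
      simp [simpleRoot, hne, hne.symm]
      ring
    · rw [Equiv.swap_apply_of_ne_of_ne h1 h2]
      simp [simpleRoot, h1, h2]

theorem weylGroup_eq_range (r : ℕ) : weylGroup r = (permIsometryHom r).range := by
  have h : Set.range (simpleReflection r) =
      permIsometryHom r '' Set.range fun i : Fin r => Equiv.swap i.castSucc i.succ := by
    rw [← Set.range_comp]
    exact congrArg Set.range (funext fun k => simpleReflection_eq_permIsometry k)
  rw [weylGroup, h, ← MonoidHom.map_closure, Subgroup.closure_eq_top_of_mclosure_eq_top
    (Equiv.Perm.mclosure_swap_castSucc_succ r), MonoidHom.range_eq_map]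

/-- The coordinates of `α̃ + ρ` are `r / 2 - shiftedIndex r i`. -/
def shiftedIndex (r : ℕ) (i : Fin (r + 1)) : ℤ :=
  if (i : ℕ) = 0 then -1 else if (i : ℕ) = r then r + 1 else (i : ℕ)

theorem highestRoot_add_weylVector_apply {r : ℕ} (hr : 1 ≤ r) (i : Fin (r + 1)) :
    (highestRoot r + weylVector r) i = (r : ℝ) / 2 - shiftedIndex r i := by
  rw [PiLp.add_apply, highestRoot_apply r hr, weylVector_apply, shiftedIndex]
  split_ifs with h1 h2 h2
  · omega
  · simp [h1]; ring
  · simp [h2]; ring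
  · simp

theorem shiftedIndex_injective {r : ℕ} : Function.Injective (shiftedIndex r) := by
  intro i j h
  have := i.2
  have := j.2
  simp only [shiftedIndex] at h
  ext
  split_ifs at h <;> omega

theorem exists_shiftedIndex_eq_iff {r : ℕ} (hr : 1 ≤ r) (z : ℤ) :
    (∃ i, shiftedIndex r i = z) ↔ z = -1 ∨ (1 ≤ z ∧ z ≤ r - 1) ∨ z = r + 1 := by
  constructor
  · rintro ⟨i, rfl⟩
    have := i.2
    simp only [shiftedIndex]
    split_ifs <;> omega
  · rintro (rfl | ⟨h1, h2⟩ | rfl)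
    · exact ⟨0, by simp [shiftedIndex]⟩
    · lift z to ℕ using by omega
      refine ⟨⟨z, by omega⟩, ?_⟩
      simp only [shiftedIndex]
      split_ifs <;> omega
    · refine ⟨Fin.last r, ?_⟩
      simp only [shiftedIndex, Fin.val_last]
      split_ifs <;> omega

theorem permIsometry_eq_sum_iff {r : ℕ} (hr : 1 ≤ r) (π : Equiv.Perm (Fin (r + 1)))
    (n : Fin r → ℕ) :
    permIsometry π (highestRoot r + weylVector r) - -highestRoot r - weylVector r =
        ∑ k, (n k : ℝ) • simpleRoot r k ↔
      ∀ i : Fin (r + 1), shiftedIndex r (π.symm i) =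
        (i : ℕ) + padded 1 (fun k => 2 - (n k : ℤ)) (i + 1) -
          padded 1 (fun k => 2 - (n k : ℤ)) i := by
  -- Passing from boundary value 0 for n to 1 for e leaves corrections at both ends, which cancel
  -- the coordinates of the α̃ coming from -μ.
  have hpad : ∀ j ≤ r + 1, (padded 0 (fun k => (n k : ℝ)) j : ℝ) =
      ((2 - padded 1 (fun k => 2 - (n k : ℤ)) j : ℤ) : ℝ) -
        (if j = 0 then 1 else 0) - if j = r + 1 then 1 else 0 := by
    intro j hj
    cases j with
    | zero => simp
    | succ j =>
      rcases Nat.lt_or_ge j r with h | h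
      · rw [padded_succ_of_lt _ _ h, padded_succ_of_lt _ _ h]
        simp [h.ne]
      · obtain rfl : j = r := by omega
        rw [padded_succ_of_le _ _ h, padded_succ_of_le _ _ h]
        simp
  rw [PiLp.ext_iff]
  refine forall_congr' fun i => ?_
  rw [sum_smul_simpleRoot_apply, hpad _ (by omega), hpad _ (by omega), PiLp.sub_apply,
    PiLp.sub_apply, PiLp.neg_apply, permIsometry_apply, highestRoot_add_weylVector_apply hr,
    highestRoot_apply r hr, weylVector_apply, ← @Int.cast_inj ℝ]
  have hi : (i : ℕ) ≠ r + 1 := i.2.ne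
  simp only [Nat.add_eq_zero_iff, one_ne_zero, and_false, if_false, Nat.add_right_cancel_iff, hi]
  push_cast
  constructor <;> intro h <;> linarith

/-- The coordinates of α̃ + ρ are distinct, so its stabiliser is trivial. -/
theorem permIsometry_injective_apply {r : ℕ} (hr : 1 ≤ r) {π π' : Equiv.Perm (Fin (r + 1))}
    (h : permIsometry π (highestRoot r + weylVector r) =
      permIsometry π' (highestRoot r + weylVector r)) : π = π' := by
  rw [← Equiv.symm_bijective.injective.eq_iff]
  ext1 i
  have := PiLp.ext_iff.1 h i
  rw [permIsometry_apply, permIsometry_apply, highestRoot_add_weylVector_apply hr,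
    highestRoot_add_weylVector_apply hr] at this
  exact shiftedIndex_injective (by exact_mod_cast sub_right_injective this)

/-! ### Neighbour sequences in terms of e. -/

theorem card_filter_val_eq_and_lt {r : ℕ} (x : Fin r → Fin 3) (a : Fin 3) (m : ℕ) :
    (Finset.univ.filter fun j : Fin r => (j : ℕ) = m ∧ x j < a).card =
      if padded 3 (fun j => (x j : ℕ)) (m + 1) < a then 1 else 0 := by
  rcases Nat.lt_or_ge m r with h | h
  · rw [padded_succ_of_lt _ _ h]
    split_ifs with hx
    · rw [Finset.card_eq_one]
      refine ⟨⟨m, h⟩, ?_⟩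
      ext j
      simp only [Finset.mem_filter, Finset.mem_univ, true_and, Finset.mem_singleton, Fin.ext_iff]
      refine ⟨And.left, ?_⟩
      rintro rfl
      exact ⟨rfl, hx⟩
    · rw [Finset.card_eq_zero, Finset.filter_eq_empty_iff]
      rintro j - ⟨rfl, hj⟩
      exact hx hj
  · rw [padded_succ_of_le _ _ h, if_neg (by omega), Finset.card_eq_zero,
      Finset.filter_eq_empty_iff]
    rintro j - ⟨rfl, -⟩
    exact j.2.not_ge h

theorem card_smaller_neighbours {r : ℕ} (x : Fin r → Fin 3) (i : Fin r) :
    (Finset.univ.filter fun j : Fin r => |(j : ℤ) - (i : ℤ)| = 1 ∧ x j < x i).card =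
      (if padded 3 (fun j => (x j : ℕ)) i < x i then 1 else 0) +
        if padded 3 (fun j => (x j : ℕ)) (i + 2) < x i then 1 else 0 := by
  have hsplit : (Finset.univ.filter fun j : Fin r => |(j : ℤ) - (i : ℤ)| = 1 ∧ x j < x i) =
      (Finset.univ.filter fun j : Fin r => (j : ℕ) + 1 = i ∧ x j < x i) ∪
        Finset.univ.filter fun j : Fin r => (j : ℕ) = i + 1 ∧ x j < x i := by
    ext j
    simp only [Finset.mem_filter, Finset.mem_univ, true_and, Finset.mem_union, ← or_and_right]
    refine and_congr_left fun _ => ?_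
    rw [abs_eq zero_le_one]
    omega
  rw [hsplit, Finset.card_union_of_disjoint, card_filter_val_eq_and_lt]
  · congr 1
    generalize x i = a
    cases (i : ℕ) with
    | zero =>
      rw [padded_zero, if_neg (by omega), Finset.card_eq_zero, Finset.filter_eq_empty_iff]
      rintro j - ⟨h, -⟩
      omega
    | succ k =>
      rw [← card_filter_val_eq_and_lt]
      simp only [Nat.add_right_cancel_iff]
  · rw [Finset.disjoint_filter]
    omega

/-- The coefficient sequence attached to a sequence in `{0, 1, 2}`: `0, 1, 2 ↦ 2, 0, 1`. -/
def toCoeff {r : ℕ} (x : Fin r → Fin 3) : Fin r → ℕ := fun k => ((x k : ℕ) + 2) % 3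

theorem toCoeff_injective {r : ℕ} : Function.Injective (toCoeff (r := r)) := by
  intro x y h
  funext k
  have := congrFun h k
  simp only [toCoeff] at this
  omega

theorem exists_toCoeff_eq {r : ℕ} {n : Fin r → ℕ} (hn : ∀ k, n k ≤ 2) : ∃ x, toCoeff x = n := by
  refine ⟨fun k => ⟨(n k + 1) % 3, Nat.mod_lt _ (by omega)⟩, ?_⟩
  funext k
  have := hn k
  simp only [toCoeff]
  omega

theorem padded_toCoeff {r : ℕ} (x : Fin r → Fin 3) (k : ℕ) :
    padded 1 (fun k => 2 - (toCoeff x k : ℤ)) k =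
      if padded 3 (fun j => (x j : ℕ)) k = 3 then (1 : ℤ)
      else 2 - (((padded 3 (fun j => (x j : ℕ)) k + 2) % 3 : ℕ) : ℤ) := by
  rw [← padded_map (fun a : ℕ => if a = 3 then (1 : ℤ) else 2 - (((a + 2) % 3 : ℕ) : ℤ))]
  simp [toCoeff, (Fin.is_lt _).ne]

theorem padded_toCoeff_mem {r : ℕ} (x : Fin r → Fin 3) (k : ℕ) :
    0 ≤ padded 1 (fun k => 2 - (toCoeff x k : ℤ)) k ∧
      padded 1 (fun k => 2 - (toCoeff x k : ℤ)) k ≤ 2 := by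
  refine padded_eq_of_forall (P := fun z : ℤ => 0 ≤ z ∧ z ≤ 2) (by simp) (fun i => ?_) k
  simp only [toCoeff]
  omega

/-- A missing neighbour is coded as 3, which is never smaller than an entry. In e it becomes 1, like
the entry 2, which is never smaller either. The entry 0 carries no condition. -/
theorem mem_neighbourSequences_iff {r : ℕ} (x : Fin r → Fin 3) {e : ℕ → ℤ}
    (he : e = padded 1 fun k => 2 - (toCoeff x k : ℤ)) :
    x ∈ neighbourSequences r ↔ ∀ k < r, (e (k + 1) = 1 → e k ≠ 1 ∧ e (k + 2) ≠ 1) ∧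
      (e (k + 1) = 2 → (e k = 0 ↔ e (k + 2) ≠ 0)) := by
  have hy : ∀ k, padded 3 (fun j => (x j : ℕ)) k ≤ 3 :=
    padded_eq_of_forall (P := fun z : ℕ => z ≤ 3) le_rfl fun i => by omega
  rw [neighbourSequences, Set.mem_ofPred_eq, Fin.forall_iff]
  refine forall₂_congr fun k hk => ?_
  have h1 : padded 3 (fun j => (x j : ℕ)) (k + 1) = x ⟨k, hk⟩ := padded_succ_of_lt _ _ hk
  have h3 : (x ⟨k, hk⟩ : ℕ) < 3 := (x ⟨k, hk⟩).2
  rw [card_smaller_neighbours, he, padded_toCoeff, padded_toCoeff, padded_toCoeff, h1]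
  have h0 := hy k
  have h2 := hy (k + 2)
  generalize padded 3 (fun j => (x j : ℕ)) k = a at *
  generalize padded 3 (fun j => (x j : ℕ)) (k + 2) = b at *
  generalize (x ⟨k, hk⟩ : ℕ) = c at *
  clear h1 hy he
  interval_cases a <;> interval_cases b <;> interval_cases c <;> simp

/-! ### The bijection. -/

/-- Every neighbour sequence is the coefficient sequence of a Weyl group element. -/
theorem exists_perm_of_mem_neighbourSequences {r : ℕ} (hr : 1 ≤ r) {x : Fin r → Fin 3}
    (hx : x ∈ neighbourSequences r) : ∃ π : Equiv.Perm (Fin (r + 1)),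
      permIsometry π (highestRoot r + weylVector r) - -highestRoot r - weylVector r =
        ∑ k, (toCoeff x k : ℝ) • simpleRoot r k := by
  have hX := (mem_neighbourSequences_iff x rfl).1 hx
  have h0 : padded (1 : ℤ) (fun k => 2 - (toCoeff x k : ℤ)) 0 = 1 := padded_zero _ _
  have h1 : padded (1 : ℤ) (fun k => 2 - (toCoeff x k : ℤ)) (r + 1) = 1 :=
    padded_succ_of_le _ _ le_rfl
  choose p hp using fun i : Fin (r + 1) => (exists_shiftedIndex_eq_iff hr _).2
    (displacement_mem h0 h1 (padded_toCoeff_mem x) hX (Nat.lt_succ_iff.1 i.2) hr)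
  have hinj : Function.Injective p := by
    have key : ∀ i j : Fin (r + 1), i < j → p i ≠ p j := fun i j hij h =>
      displacement_injOn h0 h1 (padded_toCoeff_mem x) hX hij (Nat.lt_succ_iff.1 j.2)
        (by rw [← hp, ← hp, h])
    intro i j h
    by_contra hne
    rcases lt_or_gt_of_ne hne with hij | hij
    exacts [key i j hij h, key j i hij h.symm]
  refine ⟨(Equiv.ofBijective p (Finite.injective_iff_bijective.1 hinj)).symm, ?_⟩
  exact (permIsometry_eq_sum_iff hr _ _).2 hp

theorem exists_mem_neighbourSequences_of_perm {r : ℕ} (hr : 1 ≤ r) {π : Equiv.Perm (Fin (r + 1))}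
    {n : Fin r → ℕ}
    (h : permIsometry π (highestRoot r + weylVector r) - -highestRoot r - weylVector r =
      ∑ k, (n k : ℝ) • simpleRoot r k) : ∃ x ∈ neighbourSequences r, toCoeff x = n := by
  rw [permIsometry_eq_sum_iff hr] at h
  set e : ℕ → ℤ := padded 1 fun k => 2 - (n k : ℤ) with he
  have h0 : e 0 = 1 := padded_zero _ _
  have h1 : e (r + 1) = 1 := padded_succ_of_le _ _ le_rfl
  have h2 : ∀ k, e k ≤ 2 := padded_eq_of_forall (P := fun z : ℤ => z ≤ 2) (by simp) (by simp)
  have hW : ∀ i ≤ r, (i : ℤ) + e (i + 1) - e i = -1 ∨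
      (1 ≤ (i : ℤ) + e (i + 1) - e i ∧ (i : ℤ) + e (i + 1) - e i ≤ r - 1) ∨
      (i : ℤ) + e (i + 1) - e i = r + 1 := fun i hi =>
    (exists_shiftedIndex_eq_iff hr _).1 ⟨_, h ⟨i, Nat.lt_succ_iff.2 hi⟩⟩
  have hinj : Set.InjOn (fun i : ℕ => (i : ℤ) + e (i + 1) - e i) (Set.Iic r) := by
    intro i hi j hj hij
    have := (h ⟨i, Nat.lt_succ_iff.2 hi⟩).trans (hij.trans (h ⟨j, Nat.lt_succ_iff.2 hj⟩).symm)
    exact Fin.ext_iff.1 (π.symm.injective (shiftedIndex_injective this))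
  have hn : ∀ k, n k ≤ 2 := by
    intro k
    have := (displacement_pos_iff h0 hW hinj (k := k + 1) (by omega) (by omega)).1
    rw [he, padded_succ_of_lt _ _ k.2] at this
    simp only [Fin.eta] at this
    omega
  obtain ⟨x, rfl⟩ := exists_toCoeff_eq hn
  exact ⟨x, (mem_neighbourSequences_iff x he).2
    (neighbour_condition_of_displacement h0 h1 h2 hW hinj), rfl⟩

theorem mainTheorem11 (r : ℕ) (hr : 1 ≤ r) :
    Nonempty (neighbourSequences r ≃ weylAlternationSet r (highestRoot r) (-highestRoot r)) ∧
      Nat.card (weylAlternationSet r (highestRoot r) (-highestRoot r)) =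
        Nat.card (neighbourSequences r) := by
  suffices h : Nonempty
      (neighbourSequences r ≃ weylAlternationSet r (highestRoot r) (-highestRoot r)) from
    ⟨h, (Nat.card_congr h.some).symm⟩
  have mem_weyl : ∀ π, permIsometry π ∈ weylGroup r := fun π => by
    rw [weylGroup_eq_range]; exact ⟨π, rfl⟩
  choose π hπ using fun x : neighbourSequences r => exists_perm_of_mem_neighbourSequences hr x.2
  refine ⟨Equiv.ofBijective (fun x => ⟨⟨permIsometry (π x), mem_weyl _⟩,
    kostantPartitionFunction_pos_iff.2 ⟨_, hπ x⟩⟩) ⟨fun x y hxy => ?_, ?_⟩⟩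
  · have hp : permIsometry (π x) = permIsometry (π y) :=
      congrArg Subtype.val (congrArg Subtype.val hxy)
    have hs := (hπ x).symm.trans ((by rw [hp] : _ = _).trans (hπ y))
    refine Subtype.ext (toCoeff_injective (funext fun k => ?_))
    exact_mod_cast congrFun (sum_smul_simpleRoot_injective hs) k
  · rintro ⟨⟨σ, hσ⟩, hA⟩
    obtain ⟨τ, rfl⟩ : ∃ τ, permIsometry τ = σ := by rwa [weylGroup_eq_range] at hσ
    obtain ⟨n, hn⟩ := kostantPartitionFunction_pos_iff.1 hA
    obtain ⟨x, hx, rfl⟩ := exists_mem_neighbourSequences_of_perm hr hn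
    refine ⟨⟨x, hx⟩, Subtype.ext (Subtype.ext (congrArg permIsometry ?_))⟩
    refine permIsometry_injective_apply hr ?_
    exact sub_left_injective (sub_left_injective ((hπ ⟨x, hx⟩).trans hn.symm))
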